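/- Let $\Lambda \subset \mathbb{C}$ be a lattice, let $T = \mathbb{C}/\Lambda$ be the flat torus with the Abelian differential $\omega$ induced by $dz$, and let $\sigma \subset T$ be a slit with distinct endpoints, i.e. the image in $T$ of a straight segment $[a, a+v] \subset \mathbb{C}$ on which the projection $\mathbb{C} \to T$ is injective, with $v \neq 0$. Let $\Sigma \subset T$ consist of the two endpoints of $\sigma$. A saddle connection is a straight segment of positive finite length in $T$ whose endpoints are (not necessarily distinct) points of $\Sigma$ and whose interior contains no point of $\Sigma$. Let $\Theta \subset [0,\pi)$ be the set of all $\theta \in [0,\pi)$ such that the vertical foliation $\{\operatorname{Re}(e^{i\theta}\omega) = 0\}$ of $e^{i\theta}\omega$ contains a saddle connection whose interior is disjoint from the interior of $\sigma$, together with the one $\theta \in [0,\pi)$ for which $\sigma$ itself lies in a leaf of this foliation. For $S \subset \mathbb{R}$ let $S^{*}$ denote the set of non-isolated points of $S$, put $S^{*0} = S$ and $S^{*(n+1)} = (S^{*n})^{*}$; the Cantor–Bendixson rank of $S$ is the smallest integer $n \ge 0$ with $S^{*(n+1)} = S^{*n}$. Then the Cantor–Bendixson rank of $\Theta$ is exactly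 $3$. -/

import Mathlib

/-- The derived set in the sense of Cantor and Bendixson: `S` with all its isolated points removed,
i.e. the points of `S` that are accumulation points of `S`. -/
def cantorBendixsonDerivative (S : Set ℝ) : Set ℝ := S ∩ derivedSet S

/-- `S` has Cantor-Bendixson rank `n`: `n` is the smallest natural number for which the `(n+1)`-st
and the `n`-th iterated derived sets of `S` coincide. -/
def HasCantorBendixsonRank (S : Set ℝ) (n : ℕ) : Prop :=
  IsLeast {k : ℕ | cantorBendixsonDerivative^[k + 1] S = cantorBendixsonDerivative^[k] S} n

/-- The flat torus `ℂ / Λ`; it carries the Abelian differential `ω` induced by `dz`. -/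
abbrev FlatTorus (Λ : Submodule ℤ ℂ) : Type := ℂ ⧸ Λ

/-- The straight path on the flat torus with initial point `P` and holonomy `z` (the integral of
`ω` along the path over `0 ≤ t ≤ 1`). -/
def FlatTorus.path {Λ : Submodule ℤ ℂ} (P : FlatTorus Λ) (z : ℂ) (t : ℝ) : FlatTorus Λ :=
  P + Submodule.Quotient.mk ((t : ℂ) * z)

/-- A straight segment with holonomy `z` lies in a leaf of the vertical foliation
`{Re (e^{iθ} ω) = 0}` of `e^{iθ} ω`. -/
def IsVerticalFor (θ : ℝ) (z : ℂ) : Prop := (Complex.exp (θ * Complex.I) * z).re = 0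

/-- A slit on the flat torus: a straight segment without self-intersections, whose two endpoints
may however coincide. (Injectivity forces `hol ≠ 0`.) -/
structure Slit (Λ : Submodule ℤ ℂ) where
  /-- the initial point -/
  start : FlatTorus Λ
  /-- the holonomy vector -/
  hol : ℂ
  /-- the open segment does not meet itself -/
  injOn : Set.InjOn (start.path hol) (Set.Ioo 0 1)

namespace Slit

variable {Λ : Submodule ℤ ℂ}

/-- The terminal point of the slit. -/
def finish (σ : Slit Λ) : FlatTorus Λ := σ.start.path σ.hol 1

/-- The interior of the slit (the segment without its endpoints). -/
def interior (σ : Slit Λ) : Set (FlatTorus Λ) := σ.start.path σ.hol '' Set.Ioo 0 1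

/-- The set `Σ` of marked points of the slit torus: the endpoints of the slit (the differential
itself has no singularities). -/
def marked (σ : Slit Λ) : Set (FlatTorus Λ) := {σ.start, σ.finish}

/-- The segment with initial point `P` and holonomy `z` is a saddle connection of the slit torus:
it has positive length, joins two (possibly equal) marked points, and has no marked point in its
interior. -/
structure IsSaddleConnection (σ : Slit Λ) (P : FlatTorus Λ) (z : ℂ) : Prop where
  hol_ne_zero : z ≠ 0
  start_mem : P ∈ σ.marked
  finish_mem : P.path z 1 ∈ σ.marked
  interior_notMem : ∀ t ∈ Set.Ioo (0 : ℝ) 1, P.path z t ∉ σ.marked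

/-- The set of directions `θ ∈ [0, π)` such that the vertical foliation of `e^{iθ} ω` admits a
saddle connection whose interior is disjoint from the interior of the slit; by convention the
direction of the slit itself is always included. -/
def saddleDirections (σ : Slit Λ) : Set ℝ :=
  {θ | θ ∈ Set.Ico 0 Real.pi ∧
    ((∃ (P : FlatTorus Λ) (z : ℂ), σ.IsSaddleConnection P z ∧ IsVerticalFor θ z ∧
        Disjoint (P.path z '' Set.Ioo 0 1) σ.interior) ∨
      IsVerticalFor θ σ.hol)}

end Slit

/-! Let `v` be the holonomy of the slit, `θ₀` its direction, `D` the area of the torus, and `A` the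
set of directions of lattice vectors `z` with `0 < |z × v| < D`. The iterated derived sets of `Θ`
are `A ∪ {θ₀}`, `{θ₀}`, `∅`.

For primitive `z` with `0 < z × v < D`, the slit fits strictly between two consecutive lattice lines
parallel to `z`. The segment `z` is then an admissible saddle connection, and so are the segments `y
+ k z - v` crossing the rest of the strip, where `z, y` is a basis of `Λ`. Their directions tend to
that of `z`, so `A` consists of limit points of `Θ`
(`accPt_saddleDirections_of_mem_narrowDirections`).

A saddle connection missing the slit spans with it a parallelogram with no lattice point inside.
Near a direction outside `A ∪ {θ₀}` every long parallelogram of this kind does contain a lattice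
point, so only finitely many saddle connections matter and no accumulation occurs
(`not_accPt_saddleDirections`).

Away from `θ₀`, a bound on `|z × v|` bounds `‖z‖`, so `A` can accumulate only at `θ₀`
(`eventually_notMem_narrowDirections`); it does accumulate there because the slit is embedded with
distinct endpoints (`accPt_narrowDirections`). -/

/-! ### Plane geometry: the area form and vertical directions. -/

/-- The area form on the plane: the determinant of the pair `z`, `w`. -/
def cross (z w : ℂ) : ℝ := z.re * w.im - z.im * w.re

/-- The vertical unit vector of `e^{iθ} dz`. -/
noncomputable def verticalVector (θ : ℝ) : ℂ := ⟨Real.sin θ, Real.cos θ⟩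

/-- `e₁, e₂` is a positively oriented basis of the lattice `Λ`. -/
structure IsOrientedBasis (Λ : Submodule ℤ ℂ) (e₁ e₂ : ℂ) : Prop where
  cross_pos : 0 < cross e₁ e₂
  mem_iff : ∀ x, x ∈ Λ ↔ ∃ m n : ℤ, x = m * e₁ + n * e₂

theorem isVerticalFor_iff (θ : ℝ) (z : ℂ) : IsVerticalFor θ z ↔ cross (verticalVector θ) z = 0 := by
  unfold IsVerticalFor cross verticalVector
  rw [Complex.exp_mul_I, ← Complex.ofReal_cos, ← Complex.ofReal_sin]
  simp [-Complex.ofReal_sin, -Complex.ofReal_cos]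
  constructor <;> intro h <;> linarith

theorem cross_smul_left (a : ℝ) (z w : ℂ) : cross (a * z) w = a * cross z w := by
  simp [cross]; ring

theorem cross_smul_right (a : ℝ) (z w : ℂ) : cross z (a * w) = a * cross z w := by
  simp [cross]; ring

theorem cross_add_right (z w x : ℂ) : cross z (w + x) = cross z w + cross z x := by
  simp [cross]; ring

theorem cross_sub_right (z w x : ℂ) : cross z (w - x) = cross z w - cross z x := by
  simp [cross]; ring

theorem cross_neg_right (z w : ℂ) : cross z (-w) = -cross z w := by
  simp [cross]; ring

theorem cross_neg_left (z w : ℂ) : cross (-z) w = -cross z w := by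
  simp [cross]; ring

theorem cross_swap (z w : ℂ) : cross z w = -cross w z := by
  simp [cross]; ring

/-- Cramer's rule. -/
theorem cross_smul_eq (u v x : ℂ) :
    (cross u v : ℂ) * x = (cross x v : ℝ) * u + (cross u x : ℝ) * v := by
  apply Complex.ext <;> simp [cross] <;> ring

theorem eq_of_cross_ne_zero {u v : ℂ} (h : cross u v ≠ 0) (x : ℂ) :
    x = (cross x v / cross u v : ℝ) * u + (cross u x / cross u v : ℝ) * v := by
  have h' : (cross u v : ℂ) ≠ 0 := by exact_mod_cast h
  have := cross_smul_eq u v x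
  push_cast
  field_simp
  linear_combination this

theorem verticalVector_ne_zero (θ : ℝ) : verticalVector θ ≠ 0 := by
  intro h
  have h1 := congrArg Complex.re h
  have h2 := congrArg Complex.im h
  have := Real.sin_sq_add_cos_sq θ
  simp only [verticalVector, Complex.zero_re, Complex.zero_im] at h1 h2
  simp [h1, h2] at this

/-- The component of `z` along the vertical unit vector. -/
noncomputable def verticalPart (θ : ℝ) (z : ℂ) : ℝ := Real.sin θ * z.re + Real.cos θ * z.im

theorem eq_verticalPart_smul {θ : ℝ} {z : ℂ} (h : cross (verticalVector θ) z = 0) :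
    z = (verticalPart θ z : ℝ) * verticalVector θ := by
  have := Real.sin_sq_add_cos_sq θ
  simp only [cross, verticalVector] at h
  apply Complex.ext <;>
    simp [verticalVector, verticalPart, -Complex.ofReal_sin, -Complex.ofReal_cos]
  · linear_combination (-z.re) * this - Real.cos θ * h
  · linear_combination (-z.im) * this + Real.sin θ * h

theorem norm_verticalVector (θ : ℝ) : ‖verticalVector θ‖ = 1 := by
  rw [Complex.norm_eq_sqrt_sq_add_sq]
  simp [verticalVector]

theorem cross_verticalVector (θ θ' : ℝ) :
    cross (verticalVector θ) (verticalVector θ') = Real.sin (θ - θ') := by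
  simp [cross, verticalVector, Real.sin_sub]

theorem cross_eq_zero_trans {u z w : ℂ} (hu : u ≠ 0) (hz : cross u z = 0) (hw : cross u w = 0) :
    cross z w = 0 := by
  by_contra h
  have := cross_smul_eq z w u
  rw [cross_swap] at hz
  rw [hw, neg_eq_zero.1 hz] at this
  simp [h, hu] at this

theorem eq_of_isVerticalFor {θ θ' : ℝ} {z : ℂ} (hz : z ≠ 0) (h : IsVerticalFor θ z)
    (h' : IsVerticalFor θ' z) (hθ : |θ - θ'| < Real.pi) : θ = θ' := by
  rw [isVerticalFor_iff, cross_swap, neg_eq_zero] at h h'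
  have := cross_eq_zero_trans hz h h'
  rw [cross_verticalVector] at this
  rw [abs_lt] at hθ
  linarith [(Real.sin_eq_zero_iff_of_lt_of_lt hθ.1 hθ.2).1 this]

theorem exists_isVerticalFor (z : ℂ) : ∃ θ ∈ Set.Ico 0 Real.pi, IsVerticalFor θ z := by
  by_cases h : z.re = 0
  · exact ⟨0, ⟨le_rfl, Real.pi_pos⟩, by simp [isVerticalFor_iff, cross, verticalVector, h]⟩
  · refine ⟨Real.pi / 2 - Real.arctan (z.im / z.re), ⟨?_, ?_⟩, ?_⟩
    · linarith [Real.arctan_lt_pi_div_two (z.im / z.re)]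
    · linarith [Real.neg_pi_div_two_lt_arctan (z.im / z.re)]
    · rw [isVerticalFor_iff]
      simp only [cross, verticalVector, Real.sin_pi_div_two_sub, Real.cos_pi_div_two_sub]
      have := Real.tan_mul_cos (Real.cos_arctan_pos (z.im / z.re)).ne'
      rw [Real.tan_arctan] at this
      rw [← this]
      field_simp
      ring

/-- A direction is approached from the right by the directions of vectors of small positive slope. -/
theorem accPt_of_small_slope {S : Set ℝ} {W : Set ℂ} {θ : ℝ} (hθ : θ ∈ Set.Ico 0 Real.pi)
    (hS : ∀ w ∈ W, ∀ θ' ∈ Set.Ico 0 Real.pi, IsVerticalFor θ' w → θ' ∈ S)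
    (hW : ∀ ε > 0, ∃ w ∈ W, 0 < verticalPart θ w ∧ cross (verticalVector θ) w < 0 ∧
      -cross (verticalVector θ) w < ε * verticalPart θ w) :
    AccPt θ (Filter.principal S) := by
  rw [accPt_iff_nhds]
  intro U hU
  obtain ⟨δ, hδ, hUδ⟩ := Metric.mem_nhds_iff.1 hU
  -- The bound `π - θ` keeps `θ + α` inside `[0, π)`, so no wrap-around at `π` arises.
  obtain ⟨w, hw, h1, h2, h3⟩ := hW (min δ (Real.pi - θ)) (lt_min hδ (by linarith [hθ.2]))
  set α := Real.arctan (-cross (verticalVector θ) w / verticalPart θ w) with hα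
  have hpos : 0 < -cross (verticalVector θ) w / verticalPart θ w := div_pos (by linarith) h1
  have hα0 : 0 < α := Real.arctan_pos.2 hpos
  have hlt : α < min δ (Real.pi - θ) :=
    ((Real.lt_tan hα0 (Real.arctan_lt_pi_div_two _)).trans_eq (Real.tan_arctan _)).trans ((div_lt_iff₀ h1).2 h3)
  refine ⟨θ + α, ⟨hUδ ?_, hS w hw _ ⟨by linarith [hθ.1], ?_⟩ ?_⟩, by linarith⟩
  · rw [Metric.mem_ball, Real.dist_eq, add_sub_cancel_left, abs_of_pos hα0]
    exact hlt.trans_le (min_le_left _ _)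
  · linarith [hlt.trans_le (min_le_right _ _)]
  · have ht := Real.tan_mul_cos (Real.cos_arctan_pos
      (-cross (verticalVector θ) w / verticalPart θ w)).ne'
    rw [← hα, Real.tan_arctan] at ht
    have ht' : -cross (verticalVector θ) w * Real.cos α = Real.sin α * verticalPart θ w := by
      rw [← ht]; field_simp
    rw [isVerticalFor_iff]
    simp only [cross, verticalVector, verticalPart, Real.sin_add, Real.cos_add] at ht' ⊢
    linear_combination -ht'

theorem eventually_not_isVerticalFor (θ₀ : ℝ) {z : ℂ} (hz : z ≠ 0) :
    ∀ᶠ θ in nhdsWithin θ₀ {θ₀}ᶜ, ¬ IsVerticalFor θ z := by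
  by_cases h : IsVerticalFor θ₀ z
  · have : ∀ᶠ θ in nhds θ₀, |θ - θ₀| < Real.pi := by
      filter_upwards [Metric.ball_mem_nhds θ₀ Real.pi_pos] with θ h
      simpa [Real.dist_eq] using h
    filter_upwards [nhdsWithin_le_nhds this, self_mem_nhdsWithin] with θ h1 h2 h3
    exact h2 (eq_of_isVerticalFor hz h3 h h1)
  · have hc : Continuous fun θ => cross (verticalVector θ) z := by
      unfold cross verticalVector; fun_prop
    rw [isVerticalFor_iff] at h
    refine nhdsWithin_le_nhds ?_
    filter_upwards [hc.continuousAt.eventually_ne h] with θ h1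
    rwa [isVerticalFor_iff]

theorem eventually_forall_not_isVerticalFor (θ₀ : ℝ) {F : Set ℂ} (hF : F.Finite) :
    ∀ᶠ θ in nhdsWithin θ₀ {θ₀}ᶜ, ∀ z ∈ F, z ≠ 0 → ¬ IsVerticalFor θ z := by
  rw [Filter.eventually_all_finite hF]
  intro z _
  by_cases hz : z = 0
  · simp [hz]
  · filter_upwards [eventually_not_isVerticalFor θ₀ hz] with θ h _ using h

/-! ### Lattices: oriented bases, finiteness, primitive vectors, approximation of lines. -/

theorem exists_isOrientedBasis (Λ : Submodule ℤ ℂ) [DiscreteTopology Λ] [IsZLattice ℝ Λ] :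
    ∃ e₁ e₂ : ℂ, IsOrientedBasis Λ e₁ e₂ := by
  have hfree : Module.Free ℤ Λ := ZLattice.module_free ℝ Λ
  have hfin : Module.Finite ℤ Λ := ZLattice.module_finite ℝ Λ
  have hrank : Module.finrank ℤ Λ = 2 := by
    rw [ZLattice.rank ℝ Λ, Complex.finrank_real_complex]
  let b := Module.finBasisOfFinrankEq ℤ Λ hrank
  have hmem : ∀ x, x ∈ Λ ↔ ∃ m n : ℤ, x = m * (b 0 : ℂ) + n * (b 1 : ℂ) := by
    intro x
    constructor
    · intro hx
      refine ⟨b.repr ⟨x, hx⟩ 0, b.repr ⟨x, hx⟩ 1, ?_⟩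
      have := congrArg (Subtype.val) (b.sum_repr ⟨x, hx⟩)
      rw [Fin.sum_univ_two] at this
      simpa using this.symm
    · rintro ⟨m, n, rfl⟩
      rw [← zsmul_eq_mul, ← zsmul_eq_mul]
      exact add_mem (zsmul_mem (b 0).2 m) (zsmul_mem (b 1).2 n)
  have hli := (b.ofZLatticeBasis ℝ Λ).linearIndependent
  have hne : cross (b 0 : ℂ) (b 1 : ℂ) ≠ 0 := by
    intro h
    have h0 : (b 0 : ℂ) ≠ 0 := by
      have := hli.ne_zero 0
      rwa [Module.Basis.ofZLatticeBasis_apply] at this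
    have key : ∀ s t : ℝ, s * (b 0 : ℂ) + t * (b 1 : ℂ) = 0 → s = 0 ∧ t = 0 := by
      intro s t hst
      have := Fintype.linearIndependent_iff.1 hli ![s, t]
      simp only [Fin.sum_univ_two, Module.Basis.ofZLatticeBasis_apply, Matrix.cons_val_zero,
        Matrix.cons_val_one, Complex.real_smul] at this
      have h' := this hst
      exact ⟨by simpa using h' 0, by simpa using h' 1⟩
    unfold cross at h
    have h1 := key (b 1 : ℂ).re (-(b 0 : ℂ).re) (by
      apply Complex.ext <;> simp <;> linarith)
    have h2 := key (b 1 : ℂ).im (-(b 0 : ℂ).im) (by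
      apply Complex.ext <;> simp <;> linarith)
    exact h0 (Complex.ext (by simpa using h1.2) (by simpa using h2.2))
  rcases hne.lt_or_gt with h | h
  · refine ⟨b 1, b 0, by rw [cross_swap]; linarith, fun x => (hmem x).trans ?_⟩
    rw [exists_comm]
    simp only [add_comm]
  · exact ⟨b 0, b 1, h, hmem⟩

theorem finite_inter_of_norm_le (Λ : Submodule ℤ ℂ) [DiscreteTopology Λ] (a : ℂ) (M : ℝ) :
    {z : ℂ | z - a ∈ Λ ∧ ‖z‖ ≤ M}.Finite := by
  have hd : DiscreteTopology Λ.toAddSubgroup := (inferInstance : DiscreteTopology Λ)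
  have h : (Metric.closedBall (0 : ℂ) (M + ‖a‖) ∩ (Λ.toAddSubgroup : Set ℂ)).Finite :=
    Metric.finite_isBounded_inter_isClosed DiscreteTopology.isDiscrete
      Metric.isBounded_closedBall inferInstance
  refine (h.image (· + a)).subset ?_
  rintro z ⟨hz, hM⟩
  refine ⟨z - a, ⟨?_, hz⟩, by simp⟩
  rw [mem_closedBall_zero_iff]
  linarith [norm_sub_le z a]

theorem norm_le_of_cross_le {u v z : ℂ} (h : cross u v ≠ 0) {K L : ℝ} (h1 : |cross z v| ≤ K)
    (h2 : |cross u z| ≤ L) : ‖z‖ ≤ (K * ‖u‖ + L * ‖v‖) / |cross u v| := by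
  rw [le_div_iff₀ (abs_pos.2 h)]
  have := congrArg norm (cross_smul_eq u v z)
  rw [norm_mul, Complex.norm_real, Real.norm_eq_abs] at this
  rw [mul_comm, this]
  refine (norm_add_le _ _).trans ?_
  simp only [norm_mul, Complex.norm_real, Real.norm_eq_abs]
  gcongr

namespace IsOrientedBasis

variable {Λ : Submodule ℤ ℂ} {e₁ e₂ : ℂ}

theorem exists_cross_eq (h : IsOrientedBasis Λ e₁ e₂) {z w : ℂ} (hz : z ∈ Λ) (hw : w ∈ Λ) :
    ∃ k : ℤ, cross z w = k * cross e₁ e₂ := by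
  obtain ⟨m, n, rfl⟩ := (h.mem_iff z).1 hz
  obtain ⟨p, q, rfl⟩ := (h.mem_iff w).1 hw
  refine ⟨m * q - n * p, ?_⟩
  simp [cross]
  ring

/-- Dividing the coordinates of `z` by their gcd gives `z'`; the Bézout coefficients give `y`, which
completes it to a basis. -/
theorem exists_primitive (h : IsOrientedBasis Λ e₁ e₂) {z : ℂ} (hz : z ∈ Λ) (h0 : z ≠ 0) :
    ∃ z' ∈ Λ, ∃ y ∈ Λ, cross z' y = cross e₁ e₂ ∧ ∃ g : ℝ, 1 ≤ g ∧ z = g * z' := by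
  obtain ⟨m, n, rfl⟩ := (h.mem_iff z).1 hz
  have hg : 0 < Int.gcd m n := by
    rw [Int.gcd_pos_iff]
    by_contra! hc
    exact h0 (by simp [hc.1, hc.2])
  obtain ⟨p, hp⟩ := Int.gcd_dvd_left m n
  obtain ⟨q, hq⟩ := Int.gcd_dvd_right m n
  have hb := Int.gcd_eq_gcd_ab m n
  have hone : p * Int.gcdA m n + q * Int.gcdB m n = 1 := by
    have hg' : (Int.gcd m n : ℤ) ≠ 0 := by exact_mod_cast hg.ne'
    apply mul_left_cancel₀ hg'
    linear_combination -hb - Int.gcdA m n * hp - Int.gcdB m n * hq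
  have hone' : (p : ℝ) * Int.gcdA m n + q * Int.gcdB m n = 1 := by exact_mod_cast hone
  refine ⟨p * e₁ + q * e₂, (h.mem_iff _).2 ⟨p, q, rfl⟩,
    ((-Int.gcdB m n : ℤ) : ℂ) * e₁ + (Int.gcdA m n : ℤ) * e₂, (h.mem_iff _).2 ⟨_, _, rfl⟩, ?_,
    (Int.gcd m n : ℝ), by exact_mod_cast hg, ?_⟩
  · simp [cross]
    linear_combination (e₁.re * e₂.im - e₁.im * e₂.re) * hone'
  · have hp' : (m : ℂ) = (Int.gcd m n : ℂ) * p := by exact_mod_cast hp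
    have hq' : (n : ℂ) = (Int.gcd m n : ℂ) * q := by exact_mod_cast hq
    push_cast
    linear_combination e₁ * hp' + e₂ * hq'

/-- If no lattice vector is parallel to `u`, there are lattice vectors arbitrarily close to the line
spanned by `u`, on a prescribed side of it and arbitrarily far in a prescribed direction. -/
theorem exists_cross_small [DiscreteTopology Λ] (h : IsOrientedBasis Λ e₁ e₂) {u v : ℂ}
    (huv : cross u v ≠ 0) (hu : ∀ z ∈ Λ, cross u z = 0 → z = 0) {η : ℝ} (hη : 0 < η) (M : ℝ) :
    ∃ z ∈ Λ, 0 < cross u z ∧ cross u z < η ∧ M < cross z v := by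
  let f : ℂ →+ ℝ := AddMonoidHom.mk' (cross u) (cross_add_right u)
  have hdense : Dense ((Λ.toAddSubgroup.map f : AddSubgroup ℝ) : Set ℝ) := by
    -- If the values `cross u x` were all multiples of one number, an integer relation between those
    -- at `e₁` and `e₂` would give a lattice vector parallel to `u`.
    refine (AddSubgroup.dense_or_cyclic _).resolve_right ?_
    rintro ⟨a, ha⟩
    have hc : ∀ x ∈ Λ, ∃ k : ℤ, cross u x = k * a := by
      intro x hx
      have : f x ∈ Λ.toAddSubgroup.map f := ⟨x, hx, rfl⟩
      rw [ha, AddSubgroup.mem_closure_singleton] at this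
      obtain ⟨k, hk⟩ := this
      exact ⟨k, by rw [← zsmul_eq_mul, hk]; rfl⟩
    have h1 : e₁ ∈ Λ := (h.mem_iff _).2 ⟨1, 0, by simp⟩
    have h2 : e₂ ∈ Λ := (h.mem_iff _).2 ⟨0, 1, by simp⟩
    obtain ⟨m, hm⟩ := hc _ h1
    obtain ⟨n, hn⟩ := hc _ h2
    have h3 := hu (n * e₁ + (-m : ℤ) * e₂) ((h.mem_iff _).2 ⟨_, _, rfl⟩) (by
      rw [cross_add_right, ← Complex.ofReal_intCast, ← Complex.ofReal_intCast, cross_smul_right,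
        cross_smul_right, hm, hn]
      push_cast; ring)
    have h4 := congrArg (fun x => cross x e₂) h3
    have hpos := h.cross_pos
    have hn0 : (n : ℝ) * cross e₁ e₂ = 0 := by
      simp [cross, -mul_eq_zero] at h4 ⊢
      linear_combination h4
    have hn1 : (n : ℝ) = 0 := by
      rcases mul_eq_zero.1 hn0 with h | h
      · exact h
      · linarith
    rw [hn1, zero_mul] at hn
    have := hu _ h2 hn
    simp [this, cross] at hpos
  -- Only finitely many lattice points lie in a bounded region, so a sufficiently small nonzero
  -- value of `cross u z` forces `z` to be far away.
  have step : ∀ η > 0, ∀ M : ℝ, ∃ z ∈ Λ, 0 < cross u z ∧ cross u z < η ∧ M < |cross z v| := by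
    intro η hη M
    have hF : {z : ℂ | z - 0 ∈ Λ ∧ ‖z‖ ≤ (M * ‖u‖ + η * ‖v‖) / |cross u v|}.Finite :=
      finite_inter_of_norm_le Λ 0 _
    have hclosed : IsClosed ((cross u) '' {z : ℂ | z - 0 ∈ Λ ∧
        ‖z‖ ≤ (M * ‖u‖ + η * ‖v‖) / |cross u v|} \ {0}) :=
      ((hF.image _).sdiff).isClosed
    obtain ⟨δ, hδ, hball⟩ := Metric.isOpen_iff.1 hclosed.isOpen_compl 0 (by simp)
    obtain ⟨x, ⟨z, hz, rfl⟩, hx0, hx⟩ := hdense.exists_between (lt_min hη hδ)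
    refine ⟨z, hz, hx0, hx.trans_le (min_le_left _ _), ?_⟩
    by_contra! hM
    have hx0' : 0 < cross u z := hx0
    refine hball (a := cross u z) ?_ ⟨⟨z, ⟨by simpa using hz, norm_le_of_cross_le huv hM ?_⟩, rfl⟩,
      hx0'.ne'⟩
    · rw [mem_ball_zero_iff, Real.norm_eq_abs, abs_of_pos hx0']
      exact hx.trans_le (min_le_right _ _)
    · rw [abs_of_pos hx0']
      exact (hx.trans_le (min_le_left _ _)).le
  -- If `z₂` is far away in the wrong direction, `z₁ - z₂` is far away in the right one, and it
  -- stays on the prescribed side because `z₂` is closer to the line than `z₁`.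
  obtain ⟨z₁, hz₁, h1, h2, -⟩ := step η hη 0
  obtain ⟨z₂, hz₂, h3, h4, h5⟩ := step (cross u z₁) h1 (|cross z₁ v| + |M|)
  have hM := le_abs_self M
  have hz := abs_nonneg (cross z₁ v)
  rcases le_or_gt 0 (cross z₂ v) with h6 | h6
  · rw [abs_of_nonneg h6] at h5
    exact ⟨z₂, hz₂, h3, h4.trans h2, by linarith⟩
  · rw [abs_of_neg h6] at h5
    refine ⟨z₁ - z₂, sub_mem hz₁ hz₂, ?_, ?_, ?_⟩
    · rw [cross_sub_right]; linarith
    · rw [cross_sub_right]; linarith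
    · have : cross (z₁ - z₂) v = cross z₁ v - cross z₂ v := by simp [cross]; ring
      rw [this]
      linarith [neg_abs_le (cross z₁ v)]

end IsOrientedBasis

/-! ### Lattice points in long thin parallelograms, and narrow directions. -/

/-- If the half-strip `{t u + s v | 0 < t, 0 ≤ s ≤ 1}` contains a lattice point with `s ≠ 0` and one with
`s ≠ 1`, then every long parallelogram spanned by `v` and a vector close to, but not on, the ray
through `u` contains a lattice point in its interior. -/
theorem exists_mem_parallelogram {Λ : Submodule ℤ ℂ} {u v : ℂ} {t₁ s₁ t₂ s₂ : ℝ} (ht₁ : 0 < t₁)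
    (hs₁ : 0 < s₁) (hs₁' : s₁ ≤ 1) (ht₂ : 0 < t₂) (hs₂ : 0 ≤ s₂) (hs₂' : s₂ < 1)
    (h₁ : t₁ * u + s₁ * v ∈ Λ) (h₂ : t₂ * u + s₂ * v ∈ Λ) :
    ∃ T₀ > 0, ∃ δ₀ > 0, ∀ T δ : ℝ, T₀ < T → δ ≠ 0 → |δ| < δ₀ →
      ∃ t ∈ Set.Ioo (0 : ℝ) 1, ∃ s ∈ Set.Ioo (0 : ℝ) 1, t * (T * (u + δ * v)) + s * v ∈ Λ := by
  refine ⟨max t₁ t₂, lt_max_of_lt_left ht₁, min (s₁ / t₁) ((1 - s₂) / t₂),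
    lt_min (div_pos hs₁ ht₁) (div_pos (by linarith) ht₂), ?_⟩
  intro T δ hT hδ hδ₀
  have hT₁ := (le_max_left _ _).trans_lt hT
  have hT₂ := (le_max_right _ _).trans_lt hT
  have hT0 : (T : ℂ) ≠ 0 := by exact_mod_cast (ht₁.trans hT₁).ne'
  have hd₁ := (lt_div_iff₀ ht₁).1 (hδ₀.trans_le (min_le_left _ _))
  have hd₂ := (lt_div_iff₀ ht₂).1 (hδ₀.trans_le (min_le_right _ _))
  -- In the tilted frame the coordinate `s` becomes `s - δ t`: it grows for `δ < 0`, so a point with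
  -- `s < 1` is needed, and shrinks for `δ > 0`, so one with `s > 0` is.
  rcases hδ.lt_or_gt with h | h
  · rw [abs_of_neg h] at hd₂
    have := mul_pos (neg_pos.2 h) ht₂
    refine ⟨t₂ / T, ⟨div_pos ht₂ (ht₂.trans hT₂), (div_lt_one (ht₂.trans hT₂)).2 hT₂⟩,
      s₂ - δ * t₂, ⟨by linarith, by linarith⟩, ?_⟩
    convert h₂ using 1
    push_cast
    field_simp
    ring
  · rw [abs_of_pos h] at hd₁
    have := mul_pos h ht₁
    refine ⟨t₁ / T, ⟨div_pos ht₁ (ht₁.trans hT₁), (div_lt_one (ht₁.trans hT₁)).2 hT₁⟩,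
      s₁ - δ * t₁, ⟨by linarith, by linarith⟩, ?_⟩
    convert h₁ using 1
    push_cast
    field_simp
    ring

theorem exists_int_lt_add_mul (X a : ℝ) {r : ℝ} (hr : r ≠ 0) : ∃ k : ℤ, X < a + k * r := by
  have hr2 : 0 < r * r := mul_self_pos.2 hr
  rcases hr.lt_or_gt with h | h
  · obtain ⟨k, hk⟩ := exists_int_gt ((X - a) / (-r))
    refine ⟨-k, ?_⟩
    rw [div_lt_iff₀ (by linarith)] at hk
    push_cast
    linarith
  · obtain ⟨k, hk⟩ := exists_int_gt ((X - a) / r)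
    rw [div_lt_iff₀ h] at hk
    exact ⟨k, by linarith⟩

theorem isVerticalFor_smul_iff {θ r : ℝ} (hr : r ≠ 0) (z : ℂ) :
    IsVerticalFor θ (r * z) ↔ IsVerticalFor θ z := by
  rw [isVerticalFor_iff, isVerticalFor_iff, cross_smul_right]
  simp [hr]

theorem isVerticalFor_neg_iff (θ : ℝ) (z : ℂ) : IsVerticalFor θ (-z) ↔ IsVerticalFor θ z := by
  rw [isVerticalFor_iff, isVerticalFor_iff, cross_neg_right, neg_eq_zero]

/-- The vectors `x + k z` all have the same area against `z` while their component along `z` is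
unbounded, so their directions approach that of `z`. -/
theorem accPt_of_forall_add_mul {S : Set ℝ} {θ : ℝ} (hθ : θ ∈ Set.Ico 0 Real.pi) {z x : ℂ}
    (hz : IsVerticalFor θ z) (hx : 0 < cross z x)
    (hS : ∀ k : ℤ, ∀ θ' ∈ Set.Ico 0 Real.pi, IsVerticalFor θ' (x + k * z) → θ' ∈ S) :
    AccPt θ (Filter.principal S) := by
  have hz' := eq_verticalPart_smul ((isVerticalFor_iff _ _).1 hz)
  set r := verticalPart θ z with hr
  have hr0 : r ≠ 0 := by
    intro h
    rw [hz', h] at hx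
    simp [cross] at hx
  refine accPt_of_small_slope (W := Set.range fun k : ℤ => ((-r : ℝ) : ℂ) * (x + k * z)) hθ ?_ ?_
  · rintro _ ⟨k, rfl⟩ θ' hθ' h
    exact hS k θ' hθ' ((isVerticalFor_smul_iff (neg_ne_zero.2 hr0) _).1 h)
  · intro ε hε
    obtain ⟨k, hk⟩ := exists_int_lt_add_mul (cross z x / ε) (-r * verticalPart θ x)
      (neg_ne_zero.2 (mul_self_ne_zero.2 hr0))
    have hcr : cross (verticalVector θ) (((-r : ℝ) : ℂ) * (x + k * z)) = -cross z x := by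
      rw [cross_smul_right, cross_add_right, ← Complex.ofReal_intCast, cross_smul_right,
        (isVerticalFor_iff _ _).1 hz, hz', cross_smul_left]
      ring
    have hv : verticalPart θ (((-r : ℝ) : ℂ) * (x + k * z)) =
        -r * verticalPart θ x + k * -(r * r) := by
      nth_rewrite 3 [hr]
      simp [verticalPart]
      ring
    refine ⟨_, ⟨k, rfl⟩, ?_⟩
    simp only [hcr, hv]
    refine ⟨(div_pos hx hε).trans hk, by linarith, ?_⟩
    rw [div_lt_iff₀ hε] at hk
    linarith

/-- The directions in `[0, π)` of the lattice vectors which are not parallel to `v` and span with `v`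
a parallelogram of area less than `D`. -/
def narrowDirections (Λ : Submodule ℤ ℂ) (v : ℂ) (D : ℝ) : Set ℝ :=
  {θ | θ ∈ Set.Ico 0 Real.pi ∧ ∃ z ∈ Λ, 0 < |cross z v| ∧ |cross z v| < D ∧ IsVerticalFor θ z}

/-- Near a direction transverse to `v`, the area against `v` controls the length, so only finitely
many lattice vectors are narrow there. -/
theorem eventually_notMem_narrowDirections {Λ : Submodule ℤ ℂ} [DiscreteTopology Λ] {v : ℂ}
    {D θ₀ : ℝ} (hv : ¬ IsVerticalFor θ₀ v) :
    ∀ᶠ θ in nhdsWithin θ₀ {θ₀}ᶜ, θ ∉ narrowDirections Λ v D := by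
  rw [isVerticalFor_iff] at hv
  have hc : Continuous fun θ => |cross (verticalVector θ) v| := by
    unfold cross verticalVector; fun_prop
  have h0 := abs_pos.2 hv
  set c := |cross (verticalVector θ₀) v| with hcdef
  have hev : ∀ᶠ θ in nhds θ₀, c / 2 < |cross (verticalVector θ) v| :=
    hc.continuousAt.eventually (lt_mem_nhds (half_lt_self h0))
  filter_upwards [nhdsWithin_le_nhds hev, eventually_forall_not_isVerticalFor θ₀
    (finite_inter_of_norm_le Λ 0 (D / (c / 2)))] with θ h1 h2
  rintro ⟨-, z, hz, hz0, hzD, hθz⟩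
  refine h2 z ⟨by simpa using hz, ?_⟩ ?_ hθz
  · have hz' := eq_verticalPart_smul ((isVerticalFor_iff _ _).1 hθz)
    rw [hz', cross_smul_left, abs_mul] at hzD
    rw [hz', norm_mul, norm_verticalVector, mul_one, Complex.norm_real, Real.norm_eq_abs,
      le_div_iff₀ (by linarith)]
    exact (mul_le_mul_of_nonneg_left h1.le (abs_nonneg _)).trans hzD.le
  · rintro rfl
    simp [cross] at hz0

namespace IsOrientedBasis

variable {Λ : Submodule ℤ ℂ} {e₁ e₂ : ℂ}

/-- If the line of `u` has no nonzero lattice point, lattice points close to the ray serve for both.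
Otherwise let `z'` be primitive on it: the adjacent lattice line is at height `D / |z' × v| ≤ 1`,
where `D = cross e₁ e₂`, and yields the first point, while `±z'` is the second, at height `0`. -/
theorem exists_mem_halfStrip [DiscreteTopology Λ] (h : IsOrientedBasis Λ e₁ e₂) {u v : ℂ}
    (huv : cross u v ≠ 0)
    (hu : ∀ z ∈ Λ, z ≠ 0 → cross u z = 0 → cross e₁ e₂ ≤ |cross z v|) :
    ∃ t₁ s₁ t₂ s₂ : ℝ, 0 < t₁ ∧ 0 < s₁ ∧ s₁ ≤ 1 ∧ 0 < t₂ ∧ 0 ≤ s₂ ∧ s₂ < 1 ∧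
      t₁ * u + s₁ * v ∈ Λ ∧ t₂ * u + s₂ * v ∈ Λ := by
  by_cases hirr : ∀ z ∈ Λ, cross u z = 0 → z = 0
  · set c := cross u v with hc
    have hc2 : 0 < c * c := mul_self_pos.2 huv
    -- Scaling both vectors by `c` makes the coordinates of `z` in the frame `u, v` positive
    -- whatever the sign of `c`.
    obtain ⟨z, hz, h1, h2, h3⟩ := h.exists_cross_small (u := c * u) (v := c * v)
      (by rw [cross_smul_left, cross_smul_right, ← hc]; exact mul_ne_zero huv (mul_ne_zero huv huv))
      (fun z hz hz0 => hirr z hz (by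
        rw [cross_smul_left] at hz0; exact (mul_eq_zero.1 hz0).resolve_left huv)) hc2 0
    rw [cross_smul_left] at h1 h2
    rw [cross_smul_right] at h3
    have hs : cross u z / c = c * cross u z / (c * c) := by field_simp
    have ht : cross z v / c = c * cross z v / (c * c) := by field_simp
    have hmem : ((cross z v / c : ℝ) : ℂ) * u + (cross u z / c : ℝ) * v ∈ Λ := by
      rwa [hc, ← eq_of_cross_ne_zero huv]
    have hs0 : 0 < cross u z / c := hs ▸ div_pos h1 hc2
    have hs1 : cross u z / c < 1 := hs ▸ (div_lt_one hc2).2 h2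
    have ht0 : 0 < cross z v / c := ht ▸ div_pos h3 hc2
    exact ⟨_, _, _, _, ht0, hs0, hs1.le, ht0, hs0.le, hs1, hmem, hmem⟩
  · push Not at hirr
    obtain ⟨z, hz, huz, hz0⟩ := hirr
    obtain ⟨z', hz', y, hy, hzy, g, hg, rfl⟩ := h.exists_primitive hz hz0
    have hpos := h.cross_pos
    rw [cross_smul_right] at huz
    have huz' := (mul_eq_zero.1 huz).resolve_left (by linarith)
    have hz'0 : z' ≠ 0 := by rintro rfl; simp at hz0
    have hzv := hu z' hz' hz'0 huz'
    have hzr := eq_of_cross_ne_zero huv z'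
    rw [huz', zero_div, Complex.ofReal_zero, zero_mul, add_zero] at hzr
    set r := cross z' v / cross u v with hr
    have hzv0 : cross z' v ≠ 0 := abs_pos.1 (hpos.trans_le hzv)
    have hr0 : r ≠ 0 := div_ne_zero hzv0 huv
    -- the coordinate of `y` along `v`
    have hys : cross u y / cross u v = cross e₁ e₂ / cross z' v := by
      rw [← hzy, hzr, cross_smul_left, cross_smul_left]
      field_simp
    obtain ⟨y', hy', hs0, hs1⟩ : ∃ y' ∈ Λ, 0 < cross u y' / cross u v ∧
        cross u y' / cross u v ≤ 1 := by
      rcases hzv0.lt_or_gt with hneg | hneg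
      · rw [abs_of_neg hneg] at hzv
        refine ⟨-y, neg_mem hy, ?_⟩
        rw [cross_neg_right, neg_div, hys, ← div_neg]
        exact ⟨div_pos hpos (by linarith), (div_le_one (by linarith)).2 hzv⟩
      · rw [abs_of_pos hneg] at hzv
        refine ⟨y, hy, ?_⟩
        rw [hys]
        exact ⟨div_pos hpos hneg, (div_le_one hneg).2 hzv⟩
    obtain ⟨k, hk⟩ := exists_int_lt_add_mul 0 (cross y' v / cross u v) hr0
    refine ⟨_, _, |r|, 0, hk, hs0, hs1, abs_pos.2 hr0, le_rfl, zero_lt_one, ?_, ?_⟩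
    · have : ((cross y' v / cross u v + k * r : ℝ) : ℂ) * u + (cross u y' / cross u v : ℝ) * v
          = y' + k • z' := by
        nth_rewrite 3 [eq_of_cross_ne_zero huv y']
        rw [zsmul_eq_mul]
        nth_rewrite 1 [hzr]
        push_cast
        ring
      rw [this]
      exact add_mem hy' (zsmul_mem hz' k)
    · rcases abs_choice r with h | h <;> rw [h]
      · simpa [← hzr] using hz'
      · simpa [← hzr] using hz'

/-- A direction not parallel to `v` which is not a narrow one has a punctured neighbourhood in which
only vectors of bounded length span with `v` a lattice-free open parallelogram. -/
theorem eventually_norm_le_of_latticeFree [DiscreteTopology Λ] (h : IsOrientedBasis Λ e₁ e₂)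
    {v : ℂ} {θ₀ : ℝ} (hv : ¬ IsVerticalFor θ₀ v)
    (hθ₀ : ∀ z ∈ Λ, z ≠ 0 → IsVerticalFor θ₀ z → cross e₁ e₂ ≤ |cross z v|) :
    ∃ M : ℝ, ∀ᶠ θ in nhdsWithin θ₀ {θ₀}ᶜ, ∀ w, IsVerticalFor θ w →
      (∀ t ∈ Set.Ioo (0 : ℝ) 1, ∀ s ∈ Set.Ioo (0 : ℝ) 1, t * w + s * v ∉ Λ) → ‖w‖ ≤ M := by
  set u := verticalVector θ₀ with hu
  have huv : cross u v ≠ 0 := by rwa [isVerticalFor_iff] at hv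
  have huA : ∀ z ∈ Λ, z ≠ 0 → cross u z = 0 → cross e₁ e₂ ≤ |cross z v| := fun z hz hz0 hc =>
    hθ₀ z hz hz0 ((isVerticalFor_iff _ _).2 hc)
  obtain ⟨t₁, s₁, t₂, s₂, a1, a2, a3, a4, a5, a6, a7, a8⟩ := h.exists_mem_halfStrip huv huA
  obtain ⟨T, hT, δ, hδ, hhit⟩ := exists_mem_parallelogram a1 a2 a3 a4 a5 a6 a7 a8
  -- The opposite ray is treated too, since `w` may point either way along its line.
  obtain ⟨t₁', s₁', t₂', s₂', b1, b2, b3, b4, b5, b6, b7, b8⟩ :=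
    h.exists_mem_halfStrip (u := -u) (v := v) (by rwa [cross_neg_left, neg_ne_zero])
      (fun z hz hz0 hc => huA z hz hz0 (by rwa [cross_neg_left, neg_eq_zero] at hc))
  obtain ⟨T', hT', δ', hδ', hhit'⟩ := exists_mem_parallelogram b1 b2 b3 b4 b5 b6 b7 b8
  -- `X θ` and `Y θ` are the coordinates of `verticalVector θ` in the frame `u, v`; the tilt `δ` of
  -- the parallelogram is `Y θ / X θ`.
  let X : ℝ → ℝ := fun θ => cross (verticalVector θ) v / cross u v
  let Y : ℝ → ℝ := fun θ => cross u (verticalVector θ) / cross u v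
  have hXc : Continuous X := by
    unfold X cross verticalVector; fun_prop
  have hYc : Continuous Y := by
    unfold Y cross verticalVector; fun_prop
  have hX0 : X θ₀ = 1 := div_self huv
  have hY0 : Y θ₀ = 0 := by simp [Y, hu, cross_verticalVector]
  have hX : ∀ᶠ θ in nhds θ₀, 1 / 2 < X θ :=
    hXc.continuousAt.eventually (lt_mem_nhds (by rw [hX0]; norm_num))
  have hY : ∀ᶠ θ in nhds θ₀, |Y θ| < min δ δ' / 2 :=
    hYc.abs.continuousAt.eventually (gt_mem_nhds (by
      have := lt_min hδ hδ'; simp only [hY0, abs_zero]; linarith))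
  refine ⟨2 * max T T', ?_⟩
  filter_upwards [nhdsWithin_le_nhds hX, nhdsWithin_le_nhds hY,
    eventually_not_isVerticalFor θ₀ (verticalVector_ne_zero θ₀)] with θ h1 h2 h3 w hw hfree
  have hYne : Y θ ≠ 0 := by
    refine div_ne_zero (fun hc => h3 ?_) huv
    rw [isVerticalFor_iff, cross_swap, ← hu, hc, neg_zero]
  have hXpos : 0 < X θ := by linarith
  have hne : Y θ / X θ ≠ 0 := div_ne_zero hYne hXpos.ne'
  have hle : |Y θ / X θ| < min δ δ' := by
    rw [abs_div, abs_of_pos hXpos, div_lt_iff₀ hXpos]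
    have := lt_min hδ hδ'
    nlinarith
  have hw' := eq_verticalPart_smul ((isVerticalFor_iff _ _).1 hw)
  set c := verticalPart θ w
  have hd : verticalVector θ = X θ * u + Y θ * v := eq_of_cross_ne_zero huv _
  have hXC : (X θ : ℂ) ≠ 0 := by exact_mod_cast hXpos.ne'
  have hwe : w = ((c * X θ : ℝ) : ℂ) * (u + (Y θ / X θ : ℝ) * v) := by
    rw [hw', hd]; push_cast; field_simp
  have hwe' : w = ((-c * X θ : ℝ) : ℂ) * (-u + (-(Y θ / X θ) : ℝ) * v) := by
    rw [hw', hd]; push_cast; field_simp; ring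
  have hc1 : c * X θ ≤ T := by
    by_contra! hlt
    obtain ⟨t, ht, s, hs, hmem⟩ := hhit _ _ hlt hne (hle.trans_le (min_le_left _ _))
    exact hfree t ht s hs (by rwa [hwe])
  have hc2 : -c * X θ ≤ T' := by
    by_contra! hlt
    obtain ⟨t, ht, s, hs, hmem⟩ := hhit' _ _ hlt (neg_ne_zero.2 hne)
      (by rw [abs_neg]; exact hle.trans_le (min_le_right _ _))
    exact hfree t ht s hs (by rwa [hwe'])
  have habs : |c| * X θ ≤ max T T' := by
    rcases abs_choice c with h | h <;> rw [h]
    · exact hc1.trans (le_max_left _ _)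
    · exact hc2.trans (le_max_right _ _)
  rw [hw', norm_mul, norm_verticalVector, mul_one, Complex.norm_real, Real.norm_eq_abs]
  nlinarith [abs_nonneg c]

end IsOrientedBasis

/-! ### Saddle connections translated into conditions on `Λ`. -/

namespace Slit

variable {Λ : Submodule ℤ ℂ} (σ : Slit Λ)

theorem _root_.FlatTorus.path_eq_path_iff (P : FlatTorus Λ) (z w : ℂ) (s t : ℝ) :
    P.path z s = P.path w t ↔ s * z - t * w ∈ Λ := by
  rw [FlatTorus.path, FlatTorus.path, add_right_inj, Submodule.Quotient.eq]

theorem start_eq_path_zero : σ.start = σ.start.path σ.hol 0 := by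
  simp [FlatTorus.path]

theorem finish_path_eq (z : ℂ) (t : ℝ) :
    σ.finish.path z t = σ.start.path (σ.hol + t * z) 1 := by
  simp only [finish, FlatTorus.path, add_assoc, ← Submodule.Quotient.mk_add]
  congr 2
  push_cast
  ring

/-- A period `t * σ.hol` with `t < 1` would identify the interior parameters `(1 + t) / 2` and `(1 -
t) / 2`; for `t = 1` it would identify the endpoints. -/
theorem smul_hol_notMem (hσ : σ.start ≠ σ.finish) {t : ℝ} (ht : 0 < t) (ht1 : t ≤ 1) :
    t * σ.hol ∉ Λ := by
  intro hmem
  rcases ht1.eq_or_lt with rfl | ht1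
  · apply hσ
    rw [start_eq_path_zero, finish, eq_comm, FlatTorus.path_eq_path_iff]
    simpa using hmem
  · have := σ.injOn (x₁ := (1 + t) / 2) (x₂ := (1 - t) / 2) ⟨by linarith, by linarith⟩
      ⟨by linarith, by linarith⟩ (by
        rw [FlatTorus.path_eq_path_iff]
        convert hmem using 1
        push_cast
        ring)
    linarith

theorem hol_notMem (hσ : σ.start ≠ σ.finish) : σ.hol ∉ Λ := by
  simpa using σ.smul_hol_notMem hσ one_pos le_rfl

theorem hol_ne_zero (hσ : σ.start ≠ σ.finish) : σ.hol ≠ 0 := by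
  intro h
  exact σ.hol_notMem hσ (h ▸ zero_mem Λ)

theorem start_path_mem_marked_iff (z : ℂ) (t : ℝ) :
    σ.start.path z t ∈ σ.marked ↔ t * z ∈ Λ ∨ t * z - σ.hol ∈ Λ := by
  have h1 : σ.start.path z t = σ.start ↔ t * z ∈ Λ := by
    nth_rewrite 2 [start_eq_path_zero]
    rw [FlatTorus.path_eq_path_iff]
    simp
  have h2 : σ.start.path z t = σ.finish ↔ t * z - σ.hol ∈ Λ := by
    rw [finish, FlatTorus.path_eq_path_iff]
    simp
  rw [marked, Set.mem_insert_iff, Set.mem_singleton_iff, h1, h2]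

theorem finish_path_mem_marked_iff (z : ℂ) (t : ℝ) :
    σ.finish.path z t ∈ σ.marked ↔ σ.hol + t * z ∈ Λ ∨ t * z ∈ Λ := by
  rw [finish_path_eq, start_path_mem_marked_iff]
  simp

theorem disjoint_start_path_iff (z : ℂ) :
    Disjoint (σ.start.path z '' Set.Ioo 0 1) σ.interior ↔
      ∀ t ∈ Set.Ioo (0 : ℝ) 1, ∀ s ∈ Set.Ioo (0 : ℝ) 1, t * z - s * σ.hol ∉ Λ := by
  simp only [interior, Set.disjoint_left, Set.mem_image, not_exists, not_and, forall_exists_index,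
    and_imp, forall_apply_eq_imp_iff₂]
  refine forall₄_congr fun t _ s _ => ?_
  rw [eq_comm, FlatTorus.path_eq_path_iff]

theorem disjoint_finish_path_iff (z : ℂ) :
    Disjoint (σ.finish.path z '' Set.Ioo 0 1) σ.interior ↔
      ∀ t ∈ Set.Ioo (0 : ℝ) 1, ∀ s ∈ Set.Ioo (0 : ℝ) 1, t * z + s * σ.hol ∉ Λ := by
  simp only [interior, Set.disjoint_left, Set.mem_image, not_exists, not_and, forall_exists_index,
    and_imp, forall_apply_eq_imp_iff₂]
  have key : ∀ t s : ℝ, σ.start.path σ.hol s = σ.finish.path z t ↔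
      t * z + ((1 - s : ℝ) : ℂ) * σ.hol ∈ Λ := by
    intro t s
    rw [eq_comm, finish_path_eq, FlatTorus.path_eq_path_iff]
    apply iff_of_eq
    congr 1
    push_cast
    ring
  simp only [key]
  refine forall₂_congr fun t _ => ⟨fun h s hs => ?_, fun h s hs => ?_⟩
  · simpa using h (1 - s) ⟨by linarith [hs.2], by linarith [hs.1]⟩
  · exact h (1 - s) ⟨by linarith [hs.2], by linarith [hs.1]⟩

/-- A saddle connection avoiding the slit spans a lattice-free parallelogram with the slit. -/
theorem IsSaddleConnection.latticeFree {σ : Slit Λ} {P : FlatTorus Λ} {z : ℂ}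
    (h : σ.IsSaddleConnection P z) (hd : Disjoint (P.path z '' Set.Ioo 0 1) σ.interior) :
    (z ∈ Λ ∨ z - σ.hol ∈ Λ ∨ z + σ.hol ∈ Λ) ∧ ∃ w, (w = z ∨ w = -z) ∧
      ∀ t ∈ Set.Ioo (0 : ℝ) 1, ∀ s ∈ Set.Ioo (0 : ℝ) 1, t * w + s * σ.hol ∉ Λ := by
  have hf := h.finish_mem
  rcases h.start_mem with hP | hP
  · rw [hP] at hd hf
    rw [start_path_mem_marked_iff, Complex.ofReal_one, one_mul] at hf
    rw [disjoint_start_path_iff] at hd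
    refine ⟨by tauto, -z, Or.inr rfl, fun t ht s hs hmem => hd t ht s hs ?_⟩
    convert neg_mem hmem using 1
    ring
  · rw [Set.mem_singleton_iff] at hP
    rw [hP] at hd hf
    rw [finish_path_mem_marked_iff, Complex.ofReal_one, one_mul, add_comm] at hf
    rw [disjoint_finish_path_iff] at hd
    exact ⟨by tauto, z, Or.inl rfl, hd⟩

theorem finite_hol_of_norm_le [DiscreteTopology Λ] (M : ℝ) :
    {z : ℂ | (z ∈ Λ ∨ z - σ.hol ∈ Λ ∨ z + σ.hol ∈ Λ) ∧ ‖z‖ ≤ M}.Finite := by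
  refine (((finite_inter_of_norm_le Λ 0 M).union (finite_inter_of_norm_le Λ σ.hol M)).union
    (finite_inter_of_norm_le Λ (-σ.hol) M)).subset ?_
  rintro z ⟨h, hM⟩
  simp only [Set.mem_union, Set.mem_ofPred_eq, sub_zero, sub_neg_eq_add]
  tauto

/-! ### The derived set of the saddle directions. -/

section

variable {σ} {e₁ e₂ : ℂ} (h : IsOrientedBasis Λ e₁ e₂)
include h

/-- A saddle direction that is neither narrow nor the direction of the slit is isolated. -/
theorem not_accPt_saddleDirections [DiscreteTopology Λ] (hσ : σ.start ≠ σ.finish) {θ₀ : ℝ}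
    (hθ₀ : θ₀ ∈ Set.Ico 0 Real.pi) (hv : ¬ IsVerticalFor θ₀ σ.hol)
    (hA : θ₀ ∉ narrowDirections Λ σ.hol (cross e₁ e₂)) :
    ¬ AccPt θ₀ (Filter.principal σ.saddleDirections) := by
  obtain ⟨M, hM⟩ := h.eventually_norm_le_of_latticeFree hv (fun z hz hz0 hvz => by
    by_contra! hlt
    refine hA ⟨hθ₀, z, hz, abs_pos.2 fun hc => hv ?_, hlt, hvz⟩
    rw [isVerticalFor_iff] at hvz ⊢
    rw [cross_swap, neg_eq_zero] at hvz
    exact cross_eq_zero_trans hz0 hvz hc)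
  rw [accPt_iff_frequently_nhdsNE, Filter.not_frequently]
  filter_upwards [hM, eventually_not_isVerticalFor θ₀ (σ.hol_ne_zero hσ),
    eventually_forall_not_isVerticalFor θ₀ (σ.finite_hol_of_norm_le M)] with θ h1 h2 h3
  rintro ⟨-, ⟨P, z, hz, hzv, hd⟩ | hvert⟩
  · obtain ⟨hmem, w, hw, hfree⟩ := hz.latticeFree hd
    refine h3 z ⟨hmem, ?_⟩ hz.hol_ne_zero hzv
    rcases hw with rfl | rfl
    · exact h1 _ hzv hfree
    · simpa using h1 _ ((isVerticalFor_neg_iff _ _).2 hzv) hfree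
  · exact h2 hvert

/-- Passing to the primitive vector only decreases the area against `v`; changing the sign of both
`z` and `y` makes `cross z v` positive and keeps the orientation. -/
theorem exists_primitive_of_mem_narrowDirections {v : ℂ} {θ : ℝ}
    (hθ : θ ∈ narrowDirections Λ v (cross e₁ e₂)) :
    ∃ z ∈ Λ, ∃ y ∈ Λ, cross z y = cross e₁ e₂ ∧ 0 < cross z v ∧ cross z v < cross e₁ e₂ ∧
      IsVerticalFor θ z := by
  obtain ⟨-, x, hx, hx0, hxD, hvx⟩ := hθ
  obtain ⟨z, hz, y, hy, hzy, g, hg, rfl⟩ := h.exists_primitive hx (by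
    rintro rfl; simp [cross] at hx0)
  have hg0 : 0 < g := by linarith
  rw [isVerticalFor_smul_iff hg0.ne'] at hvx
  rw [cross_smul_left, abs_mul, abs_of_pos hg0] at hx0 hxD
  have hz0 : 0 < |cross z v| := pos_of_mul_pos_right hx0 hg0.le
  have hzD : |cross z v| < cross e₁ e₂ := by nlinarith
  rcases (abs_pos.1 hz0).lt_or_gt with hs | hs
  · rw [abs_of_neg hs] at hzD
    refine ⟨-z, neg_mem hz, -y, neg_mem hy, ?_, ?_, ?_, (isVerticalFor_neg_iff _ _).2 hvx⟩
    · rw [cross_neg_left, cross_neg_right, neg_neg, hzy]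
    · rw [cross_neg_left]; linarith
    · rw [cross_neg_left]; linarith
  · rw [abs_of_pos hs] at hzD
    exact ⟨z, hz, y, hy, hzy, hs, hzD, hvx⟩

/-- A vector lying strictly between two consecutive lattice lines is not a lattice vector. -/
theorem notMem_of_cross_lt {z x : ℂ} (hz : z ∈ Λ) (h0 : 0 < cross z x)
    (h1 : cross z x < cross e₁ e₂) : x ∉ Λ := by
  intro hx
  obtain ⟨k, hk⟩ := h.exists_cross_eq hz hx
  have hD := h.cross_pos
  rw [hk] at h0 h1
  have h2 : (0 : ℝ) < k := pos_of_mul_pos_left h0 hD.le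
  have h3 : (k : ℝ) < 1 := by
    by_contra! hc
    nlinarith
  have h4 : 0 < k := by exact_mod_cast h2
  have h5 : k < 1 := by exact_mod_cast h3
  omega

/-- Area against `y` shows that the open segment `z` meets no lattice point; area against `z`
separates it from the slit and from the other endpoint. -/
theorem mem_saddleDirections_of_primitive {z y : ℂ} (hz : z ∈ Λ) (hy : y ∈ Λ)
    (hzy : cross z y = cross e₁ e₂) (hv0 : 0 < cross z σ.hol)
    (hv1 : cross z σ.hol < cross e₁ e₂) {θ : ℝ} (hθ : θ ∈ Set.Ico 0 Real.pi)
    (hvz : IsVerticalFor θ z) : θ ∈ σ.saddleDirections := by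
  have hz0 : z ≠ 0 := by rintro rfl; simp [cross] at hv0
  have hself : cross z z = 0 := by simp [cross]; ring
  refine ⟨hθ, Or.inl ⟨σ.start, z, ⟨hz0, Or.inl rfl, ?_, ?_⟩, hvz, ?_⟩⟩
  · rw [start_path_mem_marked_iff]
    simp [hz]
  · intro t ht
    rw [start_path_mem_marked_iff]
    rintro (hm | hm)
    · have hyz : cross y z = -cross e₁ e₂ := by rw [cross_swap, hzy]
      refine notMem_of_cross_lt h (neg_mem hy) (x := t * z) ?_ ?_ hm
      · rw [cross_neg_left, cross_smul_right, hyz]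
        nlinarith [h.cross_pos, ht.1]
      · rw [cross_neg_left, cross_smul_right, hyz]
        nlinarith [h.cross_pos, ht.2]
    · refine notMem_of_cross_lt h (neg_mem hz) (x := t * z - σ.hol) ?_ ?_ hm
      · rw [cross_neg_left, cross_sub_right, cross_smul_right, hself]; linarith
      · rw [cross_neg_left, cross_sub_right, cross_smul_right, hself]; linarith
  · rw [disjoint_start_path_iff]
    intro t _ s hs
    have := mul_pos hs.1 hv0
    have := mul_lt_mul_of_pos_right hs.2 hv0
    apply notMem_of_cross_lt h (neg_mem hz)
    · rw [cross_neg_left, cross_sub_right, cross_smul_right, cross_smul_right, hself]; linarith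
    · rw [cross_neg_left, cross_sub_right, cross_smul_right, cross_smul_right, hself]; linarith

/-- This segment runs from the end of the slit across the rest of the strip between two consecutive
lattice lines parallel to `z`. All the relevant differences have area against `z` strictly between
`0` and `cross e₁ e₂`. -/
theorem mem_saddleDirections_of_transverse {z y : ℂ} (hz : z ∈ Λ) (hy : y ∈ Λ)
    (hzy : cross z y = cross e₁ e₂) (hv0 : 0 < cross z σ.hol)
    (hv1 : cross z σ.hol < cross e₁ e₂) {θ : ℝ} (hθ : θ ∈ Set.Ico 0 Real.pi)
    (hvy : IsVerticalFor θ (y - σ.hol)) : θ ∈ σ.saddleDirections := by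
  have hcr : cross z (y - σ.hol) = cross e₁ e₂ - cross z σ.hol := by rw [cross_sub_right, hzy]
  refine ⟨hθ, Or.inl ⟨σ.finish, y - σ.hol, ⟨?_, Or.inr rfl, ?_, ?_⟩, hvy, ?_⟩⟩
  · intro h0
    rw [h0] at hcr
    simp [cross] at hcr hv1
    linarith
  · rw [finish_path_mem_marked_iff]
    simp [hy]
  · intro t ht
    have h1 := mul_pos ht.1 (sub_pos.2 hv1)
    have h2 := mul_lt_mul_of_pos_right ht.2 (sub_pos.2 hv1)
    rw [finish_path_mem_marked_iff]
    rintro (hm | hm)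
    · refine notMem_of_cross_lt h hz (x := σ.hol + t * (y - σ.hol)) ?_ ?_ hm
      · rw [cross_add_right, cross_smul_right, hcr]; linarith
      · rw [cross_add_right, cross_smul_right, hcr]; linarith
    · refine notMem_of_cross_lt h hz (x := t * (y - σ.hol)) ?_ ?_ hm
      · rw [cross_smul_right, hcr]; linarith
      · rw [cross_smul_right, hcr]; linarith
  · rw [disjoint_finish_path_iff]
    intro t ht s hs
    have h1 := mul_pos ht.1 (sub_pos.2 hv1)
    have h2 := mul_lt_mul_of_pos_right ht.2 (sub_pos.2 hv1)
    have h3 := mul_pos hs.1 hv0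
    have h4 := mul_lt_mul_of_pos_right hs.2 hv0
    apply notMem_of_cross_lt h hz
    · rw [cross_add_right, cross_smul_right, cross_smul_right, hcr]; linarith
    · rw [cross_add_right, cross_smul_right, cross_smul_right, hcr]; linarith

theorem narrowDirections_subset_saddleDirections :
    narrowDirections Λ σ.hol (cross e₁ e₂) ⊆ σ.saddleDirections := by
  intro θ hθ
  obtain ⟨z, hz, y, hy, hzy, h0, h1, hvz⟩ := exists_primitive_of_mem_narrowDirections h hθ
  exact mem_saddleDirections_of_primitive h hz hy hzy h0 h1 hθ.1 hvz

theorem accPt_saddleDirections_of_mem_narrowDirections {θ : ℝ}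
    (hθ : θ ∈ narrowDirections Λ σ.hol (cross e₁ e₂)) :
    AccPt θ (Filter.principal σ.saddleDirections) := by
  obtain ⟨z, hz, y, hy, hzy, h0, h1, hvz⟩ := exists_primitive_of_mem_narrowDirections h hθ
  refine accPt_of_forall_add_mul hθ.1 hvz (x := y - σ.hol) (by rw [cross_sub_right]; linarith) ?_
  intro k θ' hθ' hv'
  have hself : cross z z = 0 := by simp [cross]; ring
  refine mem_saddleDirections_of_transverse h hz (y := y + k • z)
    (add_mem hy (zsmul_mem hz k)) ?_ h0 h1 hθ' ?_
  · rw [cross_add_right, zsmul_eq_mul, ← Complex.ofReal_intCast, cross_smul_right, hself, hzy]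
    ring
  · rw [zsmul_eq_mul]
    convert hv' using 1
    ring

/-- The direction of the slit is a limit of narrow directions. -/
theorem accPt_narrowDirections [DiscreteTopology Λ] (hσ : σ.start ≠ σ.finish) {θ : ℝ}
    (hθ : θ ∈ Set.Ico 0 Real.pi) (hv : IsVerticalFor θ σ.hol) :
    AccPt θ (Filter.principal (narrowDirections Λ σ.hol (cross e₁ e₂))) := by
  have hD := h.cross_pos
  have hveq := eq_verticalPart_smul ((isVerticalFor_iff _ _).1 hv)
  set c := verticalPart θ σ.hol
  have hc0 : c ≠ 0 := by
    intro hc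
    exact σ.hol_ne_zero hσ (by rw [hveq, hc]; simp)
  by_cases hirr : ∀ z ∈ Λ, cross (verticalVector θ) z = 0 → z = 0
  · refine accPt_of_small_slope (W := {z | z ∈ Λ ∧ 0 < |cross z σ.hol| ∧
      |cross z σ.hol| < cross e₁ e₂}) hθ ?_ ?_
    · rintro z ⟨hz, h1, h2⟩ θ' hθ' hvz
      exact ⟨hθ', z, hz, h1, h2, hvz⟩
    · intro ε hε
      have hη : 0 < cross e₁ e₂ / |c| := div_pos hD (abs_pos.2 hc0)
      -- The second vector is chosen so that its area form is `verticalPart θ`; the sign of the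
      -- first gives the side required by `accPt_of_small_slope`.
      obtain ⟨z, hz, h1, h2, h3⟩ := h.exists_cross_small (u := -verticalVector θ)
        (v := ⟨-Real.cos θ, Real.sin θ⟩) (by
          have := Real.sin_sq_add_cos_sq θ
          have : cross (-verticalVector θ) ⟨-Real.cos θ, Real.sin θ⟩ = -1 := by
            simp [cross, verticalVector]; linarith
          rw [this]; norm_num)
        (fun z hz hz0 => hirr z hz (by rwa [cross_neg_left, neg_eq_zero] at hz0))
        hη (cross e₁ e₂ / |c| / ε)
      have hvp : cross z ⟨-Real.cos θ, Real.sin θ⟩ = verticalPart θ z := by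
        simp [cross, verticalPart]; ring
      rw [hvp] at h3
      rw [cross_neg_left] at h1 h2
      have hcz : |cross z σ.hol| = |c| * -cross (verticalVector θ) z := by
        rw [hveq, cross_smul_right, cross_swap, abs_mul, abs_of_pos h1]
      refine ⟨z, ⟨hz, ?_, ?_⟩, (div_pos hη hε).trans h3, by linarith, ?_⟩
      · rw [hcz]; exact mul_pos (abs_pos.2 hc0) h1
      · rw [hcz, mul_comm]; exact (lt_div_iff₀ (abs_pos.2 hc0)).1 h2
      · rw [div_lt_iff₀ hε] at h3
        linarith
  · push Not at hirr
    obtain ⟨x, hx, hx0, hxne⟩ := hirr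
    obtain ⟨z, hz, y, hy, hzy, g, hg, rfl⟩ := h.exists_primitive hx hxne
    have hvz : IsVerticalFor θ z := by
      rw [cross_smul_right] at hx0
      exact (isVerticalFor_iff _ _).2 ((mul_eq_zero.1 hx0).resolve_left (by linarith))
    have hzeq := eq_verticalPart_smul ((isVerticalFor_iff _ _).1 hvz)
    set r := verticalPart θ z
    have hr0 : r ≠ 0 := by
      intro hr
      exact hxne (by rw [hzeq, hr]; simp)
    -- The slit is strictly shorter than the primitive period parallel to it; otherwise that period,
    -- up to sign, would be `t * σ.hol` with `0 < t ≤ 1`. Hence every `y + k z` has area `|c| / |r|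
    -- * cross e₁ e₂ < cross e₁ e₂` against the slit and is narrow.
    have hlt : |c| < |r| := by
      by_contra! hle
      have hdiv : (r / c : ℝ) * σ.hol = z := by
        rw [hveq, hzeq]
        have : (c : ℂ) ≠ 0 := by exact_mod_cast hc0
        push_cast
        field_simp
      refine σ.smul_hol_notMem hσ (t := |r / c|) (abs_pos.2 (div_ne_zero hr0 hc0)) ?_ ?_
      · rw [abs_div]
        exact (div_le_one (abs_pos.2 hc0)).2 hle
      · rcases abs_choice (r / c) with h | h <;> rw [h]
        · rwa [hdiv]
        · rw [Complex.ofReal_neg, neg_mul, hdiv]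
          exact neg_mem hz
    refine accPt_of_forall_add_mul hθ hvz (x := y) (by rw [hzy]; exact hD) ?_
    intro k θ' hθ' hv'
    have hcross : |cross (y + k * z) σ.hol| * |r| = |c| * cross e₁ e₂ := by
      rw [← abs_of_pos hD, ← abs_mul, ← abs_mul, ← hzy, ← abs_neg]
      congr 1
      have h2 : cross (y + k * z) σ.hol = cross y σ.hol + k * cross z σ.hol := by
        simp [cross]; ring
      have h3 : cross z σ.hol = 0 := by
        rw [hzeq, hveq, cross_smul_left, cross_smul_right]
        simp [cross]; right; right; ring
      rw [h2, h3, hveq, cross_smul_right]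
      nth_rewrite 1 [hzeq]
      rw [cross_smul_left, cross_swap (verticalVector θ) y]
      ring
    have hr := abs_pos.2 hr0
    have hc := abs_pos.2 hc0
    refine ⟨hθ', y + k * z, ?_, ?_, ?_, hv'⟩
    · rw [← zsmul_eq_mul]
      exact add_mem hy (zsmul_mem hz k)
    · exact pos_of_mul_pos_left (hcross ▸ mul_pos hc hD) hr.le
    · by_contra! hge
      nlinarith

end

end Slit

/-! ### The iterated derived sets and the rank. -/

theorem mainTheorem6 (Λ : Submodule ℤ ℂ) [DiscreteTopology Λ] [IsZLattice ℝ Λ]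
    (σ : Slit Λ) (hσ : σ.start ≠ σ.finish) :
    HasCantorBendixsonRank σ.saddleDirections 3 := by
  obtain ⟨e₁, e₂, h⟩ := exists_isOrientedBasis Λ
  set A := narrowDirections Λ σ.hol (cross e₁ e₂)
  obtain ⟨θ₀, hθ₀, hv₀⟩ := exists_isVerticalFor σ.hol
  have huniq : ∀ θ ∈ Set.Ico 0 Real.pi, IsVerticalFor θ σ.hol → θ = θ₀ := fun θ hθ hv =>
    eq_of_isVerticalFor (σ.hol_ne_zero hσ) hv hv₀
      (abs_lt.2 ⟨by linarith [hθ.1, hθ₀.2], by linarith [hθ.2, hθ₀.1]⟩)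
  have hacc : AccPt θ₀ (Filter.principal A) := Slit.accPt_narrowDirections h hσ hθ₀ hv₀
  have hAS : A ⊆ σ.saddleDirections := Slit.narrowDirections_subset_saddleDirections h
  have hmono : ∀ {S T : Set ℝ}, S ⊆ T → ∀ {θ : ℝ}, AccPt θ (Filter.principal S) →
      AccPt θ (Filter.principal T) := fun hST θ hθ => hθ.mono (Filter.principal_mono.2 hST)
  have hone : cantorBendixsonDerivative σ.saddleDirections = insert θ₀ A := by
    ext θ
    constructor
    · rintro ⟨hθ, hθ'⟩
      by_contra hn
      rw [Set.mem_insert_iff, not_or] at hn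
      exact Slit.not_accPt_saddleDirections h hσ hθ.1 (fun hv => hn.1 (huniq θ hθ.1 hv)) hn.2 hθ'
    · rintro (rfl | hθ)
      · exact ⟨⟨hθ₀, Or.inr hv₀⟩, hmono hAS hacc⟩
      · exact ⟨hAS hθ, Slit.accPt_saddleDirections_of_mem_narrowDirections h hθ⟩
  have htwo : cantorBendixsonDerivative (insert θ₀ A) = {θ₀} := by
    ext θ
    constructor
    · rintro ⟨hθ, hθ'⟩
      by_contra hn
      rw [Set.mem_singleton_iff] at hn
      have hθA : θ ∈ A := hθ.resolve_left hn
      have hev := eventually_notMem_narrowDirections (Λ := Λ) (D := cross e₁ e₂)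
        (fun hv => hn (huniq θ hθA.1 hv))
      rw [mem_derivedSet, accPt_iff_frequently_nhdsNE] at hθ'
      refine hθ' ?_
      filter_upwards [hev, nhdsWithin_le_nhds (isOpen_ne.mem_nhds hn)] with x h1 h2
      rintro (h3 | h3)
      · exact h2 h3
      · exact h1 h3
    · rintro rfl
      exact ⟨Or.inl rfl, hmono (Set.subset_insert _ _) hacc⟩
  have hthree : cantorBendixsonDerivative {θ₀} = ∅ := by
    ext θ
    simp only [Set.mem_empty_iff_false, iff_false]
    rintro ⟨hθ, hθ'⟩
    rw [Set.mem_singleton_iff] at hθ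
    subst hθ
    rw [mem_derivedSet, accPt_iff_nhds] at hθ'
    obtain ⟨y, hy, hne⟩ := hθ' _ Filter.univ_mem
    exact hne hy.2
  have hfour : cantorBendixsonDerivative ∅ = ∅ := Set.empty_inter _
  constructor
  · simp only [Set.mem_ofPred_eq, Function.iterate_succ, Function.iterate_zero, Function.comp_apply,
      id, hone, htwo, hthree, hfour]
  · intro k hk
    by_contra! hlt
    -- Stabilisation at some `k ≤ 2` would persist and make the second and third derived sets,
    -- `{θ₀}` and `∅`, equal.
    have hstab : ∀ j, cantorBendixsonDerivative^[k + j] σ.saddleDirections =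
        cantorBendixsonDerivative^[k] σ.saddleDirections := by
      intro j
      induction j with
      | zero => rfl
      | succ j ih =>
        rw [← add_assoc, Function.iterate_succ_apply', ih]
        exact (Function.iterate_succ_apply' _ _ _).symm.trans hk
    have h2 := hstab (2 - k)
    have h3 := hstab (3 - k)
    rw [show k + (2 - k) = 2 by omega] at h2
    rw [show k + (3 - k) = 3 by omega, ← h2] at h3
    simp only [Function.iterate_succ, Function.iterate_zero, Function.comp_apply,
      id, hone, htwo, hthree] at h3
    exact (Set.singleton_ne_empty θ₀) h3.symm
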